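/- Let $-\infty<a<b<\infty$. For $\gamma>0$ and $g\in C[a,b]$ let $$J_a^{\gamma}g(x)=\frac1{\Gamma(\gamma)}\int_a^x (x-t)^{\gamma-1}g(t)\,dt\quad(a\le x\le b),\qquad J_a^0g=g .$$ For $\alpha>0$ put $m=\lceil\alpha\rceil$. A function $f:[a,b]\to\mathbb R$ of class $C^{m-1}[a,b]$, with Taylor polynomial $T_{m-1}[f;a](t)=\sum_{k=0}^{m-1}\frac{f^{(k)}(a)}{k!}(t-a)^k$, is called continuously Caputo $\alpha$-differentiable if the derivative $${}^{C}\!D_a^{\alpha}f:=D^mJ_a^{m-\alpha}\bigl(f-T_{m-1}[f;a]\bigr)$$ exists and is continuous on $[a,b]$, i.e. if $J_a^{m-\alpha}(f-T_{m-1}[f;a])\in C^m[a,b]$ (derivatives at the end points are one-sided). For $\alpha=0$, ${}^{C}\!D_a^{0}f:=f$, and $f$ is continuously Caputo $0$-differentiable if $f\in C[a,b]$. **Theorem.** Let $\alpha>0$ and $\lceil\alpha\rceil-1\le\beta<\alpha$, and let $f\in C^{\lceil\alpha\rceil-1}[a,b]$ be continuously Caputo $\alpha$-differentiable. Then: (i)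 $f$ is continuously Caputo $\beta$-differentiable, with continuous derivative ${}^{C}\!D_a^{\beta}f\in C[a,b]$. Moreover, if $\beta\notin\mathbb N=\{0,1,2,\dots\}$, then $({}^{C}\!D_a^{\beta}f)(a)=0$. (ii) The function $f_1:={}^{C}\!D_a^{\beta}f$ is continuously Caputo $(\alpha-\beta)$-differentiable, and ${}^{C}\!D_a^{\alpha-\beta}f_1={}^{C}\!D_a^{\alpha}f$ on $[a,b]$; thus ${}^{C}\!D_a^{\alpha-\beta}\,{}^{C}\!D_a^{\beta}f={}^{C}\!D_a^{\alpha}f$. -/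

import Mathlib

namespace FracCalc

noncomputable section

/-- Riemann-Liouville fractional integral `J_a^α f` of order `α`, with `J_a^0` the identity. -/
def rlIntegral (a α : ℝ) (f : ℝ → ℝ) (x : ℝ) : ℝ :=
  if α = 0 then f x
  else 1 / Real.Gamma α * ∫ t in a..x, (x - t) ^ (α - 1) * f t

/-- Riemann-Liouville fractional derivative `D^m J_a^(m - α) f` on `[a, b]`, `m = ⌈α⌉`, where the
ordinary derivatives are taken within `[a, b]` (one-sided at the end points). For `α = 0` this
is `f` itself. -/
def rlDeriv (a b α : ℝ) (f : ℝ → ℝ) (x : ℝ) : ℝ :=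
  iteratedDerivWithin ⌈α⌉₊ (rlIntegral a (⌈α⌉₊ - α) f) (Set.Icc a b) x

/-- `f - T_{m-1}[f; a]`, where `T_{m-1}[f; a]` is the Taylor polynomial of `f` of order `m - 1`,
`m = ⌈α⌉`, centered at `a`. Only used for `0 < α`, so that `1 ≤ m`. -/
def taylorRemainder (a b α : ℝ) (f : ℝ → ℝ) (x : ℝ) : ℝ :=
  f x - taylorWithinEval f (⌈α⌉₊ - 1) (Set.Icc a b) a x

/-- Caputo fractional derivative of order `α` on `[a, b]`: the Riemann-Liouville derivative of
`f - T_{m-1}[f; a]`, and the identity for `α = 0`. -/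
def caputoDeriv (a b α : ℝ) (f : ℝ → ℝ) (x : ℝ) : ℝ :=
  if α = 0 then f x else rlDeriv a b α (taylorRemainder a b α f) x

/-- `f` is continuously Caputo `α`-differentiable on `[a, b]`: for `0 < α` and `m = ⌈α⌉`, the
function `f` is in `C^(m-1)[a, b]`, and `D^m J_a^(m - α) (f - T_{m-1}[f; a])` exists and is
continuous on `[a, b]`, that is, `J_a^(m - α) (f - T_{m-1}[f; a])` is in `C^m[a, b]`.
For `α = 0` it says that `f` is in `C[a, b]`. -/
def ContCaputoDiff (a b α : ℝ) (f : ℝ → ℝ) : Prop :=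
  if α = 0 then ContinuousOn f (Set.Icc a b)
  else
    ContDiffOn ℝ ((⌈α⌉₊ - 1 : ℕ) : WithTop ℕ∞) f (Set.Icc a b) ∧
    ContDiffOn ℝ (⌈α⌉₊ : WithTop ℕ∞)
      (rlIntegral a (⌈α⌉₊ - α) (taylorRemainder a b α f)) (Set.Icc a b)

end

end FracCalc

open Set MeasureTheory intervalIntegral Filter
open scoped Interval

namespace FracCalc

theorem rlIntegral_zero (a : ℝ) (g : ℝ → ℝ) : rlIntegral a 0 g = g := by
  ext x; simp [rlIntegral]

theorem rlIntegral_of_pos {γ : ℝ} (hγ : 0 < γ) (a : ℝ) (g : ℝ → ℝ) (x : ℝ) :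
    rlIntegral a γ g x = 1 / Real.Gamma γ * ∫ t in a..x, (x - t) ^ (γ - 1) * g t := by
  simp [rlIntegral, hγ.ne']

theorem rlIntegral_one (a : ℝ) (g : ℝ → ℝ) (x : ℝ) :
    rlIntegral a 1 g x = ∫ t in a..x, g t := by
  simp [rlIntegral]

theorem rlIntegral_left {γ : ℝ} (hγ : 0 < γ) (a : ℝ) (g : ℝ → ℝ) : rlIntegral a γ g a = 0 := by
  simp [rlIntegral_of_pos hγ]

theorem rlIntegral_congr {a b : ℝ} {g h : ℝ → ℝ} (γ : ℝ) (hgh : EqOn g h (Icc a b)) :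
    EqOn (rlIntegral a γ g) (rlIntegral a γ h) (Icc a b) := by
  intro x hx
  unfold rlIntegral
  split_ifs
  · exact hgh hx
  · congr 1
    refine integral_congr fun t ht => ?_
    rw [uIcc_of_le hx.1] at ht
    simp only [hgh ⟨ht.1, ht.2.trans hx.2⟩]

theorem intervalIntegrable_sub_rpow {γ : ℝ} (hγ : 0 < γ) (a x : ℝ) :
    IntervalIntegrable (fun t => (x - t) ^ (γ - 1)) volume a x := by
  have h := (intervalIntegrable_rpow' (a := x - a) (b := 0)
    (show -1 < γ - 1 by linarith)).comp_sub_left x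
  simpa using h

/-- The substitution `t = a + (x - a) u` in the fractional integral. -/
theorem rlIntegral_eq_rpow_mul {γ : ℝ} (hγ : 0 < γ) {a x : ℝ} (hx : a ≤ x) (g : ℝ → ℝ) :
    rlIntegral a γ g x = 1 / Real.Gamma γ *
      ((x - a) ^ γ * ∫ u in (0 : ℝ)..1, (1 - u) ^ (γ - 1) * g (a + (x - a) * u)) := by
  rw [rlIntegral_of_pos hγ]
  congr 1
  rcases hx.eq_or_lt with rfl | hx
  · simp [Real.zero_rpow hγ.ne']
  have hpos : 0 < x - a := sub_pos.2 hx
  have h := smul_integral_comp_add_mul (a := 0) (b := 1)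
    (fun t : ℝ => (x - t) ^ (γ - 1) * g t) (x - a) a
  rw [mul_zero, add_zero, mul_one, add_sub_cancel] at h
  rw [← h]
  have hpow : (x - a) ^ γ = (x - a) * (x - a) ^ (γ - 1) := by
    rw [← Real.rpow_one_add' hpos.le (by linarith), add_sub_cancel]
  rw [smul_eq_mul, hpow, mul_assoc,
    ← intervalIntegral.integral_const_mul ((x - a) ^ (γ - 1))]
  congr 1
  refine intervalIntegral.integral_congr fun u hu => ?_
  rw [uIcc_of_le zero_le_one] at hu
  rw [show x - (a + (x - a) * u) = (x - a) * (1 - u) by ring,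
    Real.mul_rpow hpos.le (by linarith [hu.2]), mul_assoc]

theorem continuousOn_rlIntegral {γ a b : ℝ} (hγ : 0 ≤ γ) {g : ℝ → ℝ}
    (hg : ContinuousOn g (Icc a b)) : ContinuousOn (rlIntegral a γ g) (Icc a b) := by
  rcases hγ.eq_or_lt with rfl | hγ
  · rwa [rlIntegral_zero]
  refine ContinuousOn.congr ?_ fun x hx => rlIntegral_eq_rpow_mul hγ hx.1 g
  refine continuousOn_const.mul (ContinuousOn.mul ?_ ?_)
  · exact (continuousOn_id.sub continuousOn_const).rpow_const fun x _ => Or.inr hγ.le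
  obtain ⟨C, hC⟩ := isCompact_Icc.exists_bound_of_continuousOn hg
  have hmem : ∀ x ∈ Icc a b, ∀ u ∈ Icc (0 : ℝ) 1, a + (x - a) * u ∈ Icc a b := fun x hx u hu =>
    ⟨by nlinarith [hx.1, hu.1], by nlinarith [hx.1, hx.2, hu.1, hu.2]⟩
  have hker := intervalIntegrable_sub_rpow hγ 0 1
  have hIoc : ∀ u ∈ Ι (0 : ℝ) 1, u ∈ Icc (0 : ℝ) 1 := fun u hu => by
    rw [uIoc_of_le zero_le_one] at hu; exact Ioc_subset_Icc_self hu
  intro x₀ hx₀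
  refine continuousWithinAt_of_dominated_interval
    (bound := fun u => (1 - u) ^ (γ - 1) * C) ?_ ?_ (hker.mul_const C) ?_
  · filter_upwards [self_mem_nhdsWithin] with x hx
    refine (intervalIntegrable_iff.1 hker).aestronglyMeasurable.mul ?_
    refine ContinuousOn.aestronglyMeasurable ?_ measurableSet_uIoc
    exact hg.comp (by fun_prop) fun u hu => hmem x hx u (hIoc u hu)
  · filter_upwards [self_mem_nhdsWithin] with x hx
    refine Eventually.of_forall fun u hu => ?_
    have hu' := hIoc u hu
    have hk : 0 ≤ (1 - u) ^ (γ - 1) := Real.rpow_nonneg (by linarith [hu'.2]) _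
    rw [norm_mul, Real.norm_of_nonneg hk]
    exact mul_le_mul_of_nonneg_left (hC _ (hmem x hx u hu')) hk
  · refine Eventually.of_forall fun u hu => continuousWithinAt_const.mul ?_
    exact ContinuousWithinAt.comp (f := fun x => a + (x - a) * u) (t := Icc a b)
      (hg _ (hmem x₀ hx₀ u (hIoc u hu))) (by fun_prop) fun x hx => hmem x hx u (hIoc u hu)

/-- The beta integral over `[s, x]`. -/
theorem integral_sub_rpow_mul_sub_rpow {γ δ : ℝ} (hγ : 0 < γ) (hδ : 0 < δ) {s x : ℝ}
    (hsx : s < x) :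
    ∫ t in s..x, (x - t) ^ (γ - 1) * (t - s) ^ (δ - 1) =
      Real.Gamma γ * Real.Gamma δ / Real.Gamma (γ + δ) * (x - s) ^ (γ + δ - 1) := by
  have hpos : 0 < x - s := sub_pos.2 hsx
  have h := Complex.betaIntegral_scaled δ γ hpos
  rw [Complex.betaIntegral_eq_Gamma_mul_div _ _ (by simpa) (by simpa)] at h
  have h1 : ∫ t in s..x, (x - t) ^ (γ - 1) * (t - s) ^ (δ - 1) =
      ∫ r in (0 : ℝ)..(x - s), r ^ (δ - 1) * ((x - s) - r) ^ (γ - 1) := by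
    have := integral_comp_sub_right (a := s) (b := x)
      (fun r => r ^ (δ - 1) * ((x - s) - r) ^ (γ - 1)) s
    rw [sub_self] at this
    rw [← this]
    refine integral_congr fun t _ => ?_
    simp only [sub_sub_sub_cancel_right]
    ring
  have h2 : ((∫ r in (0 : ℝ)..(x - s), r ^ (δ - 1) * ((x - s) - r) ^ (γ - 1) : ℝ) : ℂ) =
      ∫ r in (0 : ℝ)..(x - s), (r : ℂ) ^ ((δ : ℂ) - 1) * (((x - s : ℝ) : ℂ) - r) ^ ((γ : ℂ) - 1) := by
    rw [← intervalIntegral.integral_ofReal]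
    refine integral_congr fun r hr => ?_
    rw [uIcc_of_le hpos.le] at hr
    simp only [Complex.ofReal_mul]
    rw [Complex.ofReal_cpow hr.1, Complex.ofReal_cpow (sub_nonneg.2 hr.2)]
    push_cast
    rfl
  rw [h1]
  apply Complex.ofReal_injective
  rw [h2, h]
  have h3 : ((x - s : ℝ) : ℂ) ^ ((δ : ℂ) + γ - 1) = (((x - s) ^ (γ + δ - 1) : ℝ) : ℂ) := by
    rw [Complex.ofReal_cpow hpos.le]; push_cast; congr 1; ring
  rw [h3, Complex.Gamma_ofReal, Complex.Gamma_ofReal, ← Complex.ofReal_add, Complex.Gamma_ofReal,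
    add_comm δ γ]
  push_cast
  ring

/-- The kernel of the iterated fractional integral is integrable on the square. -/
theorem integrable_iterated_kernel {γ δ : ℝ} (hγ : 0 < γ) (hδ : 0 < δ) {a x : ℝ}
    (hax : a ≤ x) {g : ℝ → ℝ} (hg : ContinuousOn g (Icc a x)) :
    Integrable (Function.uncurry fun s t =>
        (x - t) ^ (γ - 1) * (Ici s).indicator (fun t => (t - s) ^ (δ - 1)) t * g s)
      ((volume.restrict (Ioc a x)).prod (volume.restrict (Ioc a x))) := by
  have h1 : Integrable ((Ioc a x).indicator fun t => (x - t) ^ (γ - 1)) := by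
    rw [integrable_indicator_iff measurableSet_Ioc]
    exact (intervalIntegrable_iff_integrableOn_Ioc_of_le hax).1
      (intervalIntegrable_sub_rpow hγ a x)
  have h2 : Integrable ((Ioc (a - x) 0).indicator fun r => (0 - r) ^ (δ - 1)) := by
    rw [integrable_indicator_iff measurableSet_Ioc]
    exact (intervalIntegrable_iff_integrableOn_Ioc_of_le (by linarith)).1
      (intervalIntegrable_sub_rpow hδ (a - x) 0)
  have h3 := (h1.convolution_integrand (ContinuousLinearMap.mul ℝ ℝ) h2).integrableOn
    (s := Ioc a x ×ˢ Ioc a x)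
  obtain ⟨C, hC⟩ := isCompact_Icc.exists_bound_of_continuousOn hg
  have h4 : AEStronglyMeasurable (fun p : ℝ × ℝ => g p.1)
      ((volume.restrict (Ioc a x)).prod (volume.restrict (Ioc a x))) :=
    ((hg.mono Ioc_subset_Icc_self).aestronglyMeasurable measurableSet_Ioc).comp_fst
  rw [Measure.prod_restrict] at h4 ⊢
  have hmeas : MeasurableSet (Ioc a x ×ˢ Ioc a x) := measurableSet_Ioc.prod measurableSet_Ioc
  have h5 := Integrable.mul_bdd (c := C) h3 h4 ((ae_restrict_iff' hmeas).2
    (Eventually.of_forall fun p hp => hC _ (Ioc_subset_Icc_self hp.1)))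
  refine h5.congr ((ae_restrict_iff' hmeas).2 (Eventually.of_forall ?_))
  rintro ⟨s, t⟩ ⟨hs, ht⟩
  simp only at hs ht
  simp only [Function.uncurry, ContinuousLinearMap.mul_apply']
  rw [indicator_of_mem ht]
  by_cases hst : s ≤ t
  · rw [indicator_of_mem (mem_Ici.2 hst), indicator_of_mem
      (show s - t ∈ Ioc (a - x) 0 from ⟨by linarith [hs.1, ht.2], by linarith⟩)]
    congr 3
    ring
  · rw [indicator_of_notMem (fun h : s - t ∈ Ioc (a - x) 0 => hst (by linarith [h.2])),
      indicator_of_notMem (fun h : t ∈ Ici s => hst h)]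

/-- The semigroup property of fractional integrals. -/
theorem rlIntegral_rlIntegral {γ δ a b : ℝ} (hγ : 0 ≤ γ) (hδ : 0 ≤ δ) {g : ℝ → ℝ}
    (hg : ContinuousOn g (Icc a b)) :
    EqOn (rlIntegral a γ (rlIntegral a δ g)) (rlIntegral a (γ + δ) g) (Icc a b) := by
  rcases hγ.eq_or_lt with rfl | hγ
  · rw [rlIntegral_zero, zero_add]; exact eqOn_refl _ _
  rcases hδ.eq_or_lt with rfl | hδ
  · rw [rlIntegral_zero, add_zero]; exact eqOn_refl _ _
  intro x hx
  have hgx : ContinuousOn g (Icc a x) := hg.mono (Icc_subset_Icc_right hx.2)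
  have hleft : ∫ t in a..x, (x - t) ^ (γ - 1) * rlIntegral a δ g t =
      1 / Real.Gamma δ * ∫ t in Ioc a x, ∫ s in Ioc a x,
        (x - t) ^ (γ - 1) * (Ici s).indicator (fun t => (t - s) ^ (δ - 1)) t * g s := by
    rw [integral_of_le hx.1, ← MeasureTheory.integral_const_mul]
    refine setIntegral_congr_fun measurableSet_Ioc fun t ht => ?_
    rw [rlIntegral_of_pos hδ, integral_of_le ht.1.le]
    have : ∫ s in Ioc a x,
        (x - t) ^ (γ - 1) * (Ici s).indicator (fun t => (t - s) ^ (δ - 1)) t * g s =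
        (x - t) ^ (γ - 1) * ∫ s in Ioc a t, (t - s) ^ (δ - 1) * g s := by
      rw [← MeasureTheory.integral_const_mul]
      have hsub : Ioc a t = Ioc a x ∩ Iic t := by
        ext s; simp only [mem_Ioc, mem_inter_iff, mem_Iic]
        exact ⟨fun h => ⟨⟨h.1, h.2.trans ht.2⟩, h.2⟩, fun h => ⟨h.1.1, h.2⟩⟩
      rw [hsub, ← setIntegral_indicator measurableSet_Iic]
      refine setIntegral_congr_fun measurableSet_Ioc fun s _ => ?_
      by_cases hst : s ≤ t
      · simp [indicator, hst, mul_assoc]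
      · simp [indicator, hst]
    rw [this]
    ring
  have hright : ∫ s in Ioc a x, ∫ t in Ioc a x,
        (x - t) ^ (γ - 1) * (Ici s).indicator (fun t => (t - s) ^ (δ - 1)) t * g s =
      Real.Gamma γ * Real.Gamma δ / Real.Gamma (γ + δ) *
        ∫ s in a..x, (x - s) ^ (γ + δ - 1) * g s := by
    rw [integral_of_le hx.1, ← MeasureTheory.integral_const_mul, integral_Ioc_eq_integral_Ioo,
      integral_Ioc_eq_integral_Ioo (f := fun s => _ * ((x - s) ^ (γ + δ - 1) * g s))]
    refine setIntegral_congr_fun measurableSet_Ioo fun s hs => ?_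
    rw [MeasureTheory.integral_mul_const, ← mul_assoc, ← integral_sub_rpow_mul_sub_rpow hγ hδ hs.2,
      integral_of_le hs.2.le, ← integral_Icc_eq_integral_Ioc (x := s)]
    congr 1
    have hsub : Icc s x = Ioc a x ∩ Ici s := by
      ext t; simp only [mem_Ioc, mem_inter_iff, mem_Ici, mem_Icc]
      exact ⟨fun h => ⟨⟨hs.1.trans_le h.1, h.2⟩, h.1⟩, fun h => ⟨h.2, h.1.2⟩⟩
    rw [hsub, ← setIntegral_indicator measurableSet_Ici]
    refine setIntegral_congr_fun measurableSet_Ioc fun t _ => ?_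
    simp only [indicator]
    split_ifs <;> simp
  have hΓγ := (Real.Gamma_pos_of_pos hγ).ne'
  have hΓδ := (Real.Gamma_pos_of_pos hδ).ne'
  rw [rlIntegral_of_pos hγ, rlIntegral_of_pos (add_pos hγ hδ), hleft,
    ← integral_integral_swap (integrable_iterated_kernel hγ hδ hx.1 hgx), hright]
  field_simp

theorem hasDerivWithinAt_rlIntegral_one {a b : ℝ} {g : ℝ → ℝ} (hg : ContinuousOn g (Icc a b))
    {x : ℝ} (hx : x ∈ Icc a b) : HasDerivWithinAt (rlIntegral a 1 g) (g x) (Icc a b) x := by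
  have hfun : rlIntegral a 1 g = fun x => ∫ t in a..x, g t := funext (rlIntegral_one a g)
  rw [hfun]
  have : Fact (x ∈ Icc a b) := ⟨hx⟩
  have hint : IntervalIntegrable g volume a x := by
    refine ContinuousOn.intervalIntegrable (hg.mono ?_)
    rw [uIcc_of_le hx.1]; exact Icc_subset_Icc_right hx.2
  exact integral_hasDerivWithinAt_right hint
    (hg.stronglyMeasurableAtFilter_nhdsWithin measurableSet_Icc x) (hg x hx)

/-- The fundamental theorem of calculus for functions vanishing at the left end point. -/
theorem eqOn_rlIntegral_one {a b : ℝ} {u g : ℝ → ℝ} (hg : ContinuousOn g (Icc a b))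
    (hu : ∀ x ∈ Icc a b, HasDerivWithinAt u (g x) (Icc a b) x) (hua : u a = 0) :
    EqOn u (rlIntegral a 1 g) (Icc a b) := by
  intro x hx
  have hsub : Icc a x ⊆ Icc a b := Icc_subset_Icc_right hx.2
  rw [rlIntegral_one, integral_eq_sub_of_hasDeriv_right_of_le hx.1
    (fun t ht => ((hu t (hsub ht)).continuousWithinAt).mono hsub)
    (fun t ht => ((hu t (hsub (Ioo_subset_Icc_self ht))).hasDerivAt
      (Icc_mem_nhds ht.1 (ht.2.trans_le hx.2))).hasDerivWithinAt)
    ((hg.mono (by rwa [uIcc_of_le hx.1])).intervalIntegrable), hua, sub_zero]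

theorem hasDerivWithinAt_rlIntegral_succ {a b : ℝ} {g : ℝ → ℝ}
    (hg : ContinuousOn g (Icc a b)) (n : ℕ) {x : ℝ} (hx : x ∈ Icc a b) :
    HasDerivWithinAt (rlIntegral a ((n + 1 : ℕ) : ℝ) g) (rlIntegral a n g x) (Icc a b) x := by
  have h := rlIntegral_rlIntegral (γ := 1) (δ := n) zero_le_one n.cast_nonneg hg
  rw [show (1 : ℝ) + n = ((n + 1 : ℕ) : ℝ) by push_cast; ring] at h
  exact (hasDerivWithinAt_rlIntegral_one (continuousOn_rlIntegral n.cast_nonneg hg) hx).congr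
    h.symm (h hx).symm

theorem iteratedDerivWithin_rlIntegral {a b : ℝ} (hab : a < b) {g : ℝ → ℝ}
    (hg : ContinuousOn g (Icc a b)) (n : ℕ) :
    EqOn (iteratedDerivWithin n (rlIntegral a n g) (Icc a b)) g (Icc a b) := by
  induction n with
  | zero => simp [rlIntegral_zero, eqOn_refl]
  | succ n ih =>
    intro x hx
    rw [iteratedDerivWithin_succ', ← ih hx]
    refine iteratedDerivWithin_congr (fun y hy => ?_) hx
    exact (hasDerivWithinAt_rlIntegral_succ hg n hy).derivWithin (uniqueDiffOn_Icc hab y hy)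

theorem contDiffOn_rlIntegral {a b : ℝ} (hab : a < b) {g : ℝ → ℝ}
    (hg : ContinuousOn g (Icc a b)) (n : ℕ) :
    ContDiffOn ℝ n (rlIntegral a n g) (Icc a b) := by
  induction n with
  | zero => simpa [rlIntegral_zero] using hg
  | succ n ih =>
    have h := fun x hx => hasDerivWithinAt_rlIntegral_succ hg n (x := x) hx
    push_cast at h ⊢
    rw [contDiffOn_succ_iff_derivWithin (uniqueDiffOn_Icc hab)]
    refine ⟨fun x hx => (h x hx).differentiableWithinAt, by simp, ih.congr fun x hx => ?_⟩
    exact (h x hx).derivWithin (uniqueDiffOn_Icc hab x hx)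

/-- Fractional integrals of order in `[0, 1]` are injective on continuous functions. -/
theorem eqOn_of_rlIntegral_eqOn {γ a b : ℝ} (hab : a < b) (hγ : 0 ≤ γ) (hγ1 : γ ≤ 1)
    {g h : ℝ → ℝ} (hg : ContinuousOn g (Icc a b)) (hh : ContinuousOn h (Icc a b))
    (hgh : EqOn (rlIntegral a γ g) (rlIntegral a γ h) (Icc a b)) : EqOn g h (Icc a b) := by
  have key : EqOn (rlIntegral a 1 g) (rlIntegral a 1 h) (Icc a b) := by
    have h1 := rlIntegral_rlIntegral (sub_nonneg.2 hγ1) hγ hg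
    have h2 := rlIntegral_rlIntegral (sub_nonneg.2 hγ1) hγ hh
    rw [sub_add_cancel] at h1 h2
    exact h1.symm.trans ((rlIntegral_congr _ hgh).trans h2)
  intro x hx
  have hu := uniqueDiffOn_Icc hab x hx
  rw [← (hasDerivWithinAt_rlIntegral_one hg hx).derivWithin hu,
    ← (hasDerivWithinAt_rlIntegral_one hh hx).derivWithin hu]
  exact derivWithin_congr key (key hx)

/-- Taylor's formula, with the remainder as an iterated integral. -/
theorem sub_taylorWithinEval_eqOn {a b : ℝ} (hab : a < b) (n : ℕ) {f : ℝ → ℝ}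
    (hf : ContDiffOn ℝ n f (Icc a b)) :
    EqOn (fun x => f x - taylorWithinEval f n (Icc a b) a x)
      (rlIntegral a n fun x => iteratedDerivWithin n f (Icc a b) x -
        iteratedDerivWithin n f (Icc a b) a) (Icc a b) := by
  induction n generalizing f with
  | zero => intro x _; simp [rlIntegral_zero]
  | succ n ih =>
    have hu := uniqueDiffOn_Icc hab
    have hψ : ContinuousOn (fun x => iteratedDerivWithin (n + 1) f (Icc a b) x -
        iteratedDerivWithin (n + 1) f (Icc a b) a) (Icc a b) :=
      (hf.continuousOn_iteratedDerivWithin le_rfl hu).sub continuousOn_const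
    have hf' := hf
    push_cast at hf'
    rw [contDiffOn_succ_iff_derivWithin hu] at hf'
    have ih' := ih hf'.2.2
    simp only [← iteratedDerivWithin_succ'] at ih'
    have h1 := eqOn_rlIntegral_one (u := fun x => f x - taylorWithinEval f (n + 1) (Icc a b) a x)
      (continuousOn_rlIntegral n.cast_nonneg hψ) (fun x hx => by
        rw [← ih' hx]
        exact (hf'.1 x hx).hasDerivWithinAt.sub
          (hasDerivAt_taylorWithinEval_succ f n).hasDerivWithinAt) (by simp)
    have h2 := rlIntegral_rlIntegral (γ := 1) (δ := n) zero_le_one n.cast_nonneg hψ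
    rw [show (1 : ℝ) + n = ((n + 1 : ℕ) : ℝ) by push_cast; ring] at h2
    exact h1.trans h2

theorem taylorRemainder_eqOn {a b α : ℝ} (hab : a < b) {k : ℕ} (hk : ⌈α⌉₊ = k + 1) {f : ℝ → ℝ}
    (hf : ContDiffOn ℝ k f (Icc a b)) :
    EqOn (taylorRemainder a b α f) (rlIntegral a k fun x => iteratedDerivWithin k f (Icc a b) x -
      iteratedDerivWithin k f (Icc a b) a) (Icc a b) := by
  have h : taylorRemainder a b α f = fun x => f x - taylorWithinEval f k (Icc a b) a x := by
    ext x; simp [taylorRemainder, hk]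
  rw [h]
  exact sub_taylorWithinEval_eqOn hab k hf

theorem continuousOn_caputoDeriv {a b α : ℝ} (hab : a < b) {f : ℝ → ℝ}
    (hf : ContCaputoDiff a b α f) : ContinuousOn (caputoDeriv a b α f) (Icc a b) := by
  by_cases hα : α = 0
  · have h : caputoDeriv a b α f = f := by ext x; simp [caputoDeriv, hα]
    rw [h]
    simpa [ContCaputoDiff, hα] using hf
  · have h : caputoDeriv a b α f = iteratedDerivWithin ⌈α⌉₊
        (rlIntegral a (⌈α⌉₊ - α) (taylorRemainder a b α f)) (Icc a b) := by
      ext x; simp [caputoDeriv, hα, rlDeriv]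
    rw [ContCaputoDiff, if_neg hα] at hf
    rw [h]
    exact hf.2.continuousOn_iteratedDerivWithin le_rfl (uniqueDiffOn_Icc hab)

/-- If the remainder of `f`, integrated to order `⌈α⌉₊ - α`, is the `⌈α⌉₊`-fold integral of a
continuous function, then that function is the Caputo derivative of `f`. -/
theorem contCaputoDiff_of_rlIntegral_eqOn {a b α : ℝ} (hab : a < b) (hα : 0 < α) {f φ : ℝ → ℝ}
    (hf : ContDiffOn ℝ ((⌈α⌉₊ - 1 : ℕ) : WithTop ℕ∞) f (Icc a b))
    (hφ : ContinuousOn φ (Icc a b))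
    (h : EqOn (rlIntegral a (⌈α⌉₊ - α) (taylorRemainder a b α f)) (rlIntegral a ⌈α⌉₊ φ)
      (Icc a b)) :
    ContCaputoDiff a b α f ∧ EqOn (caputoDeriv a b α f) φ (Icc a b) := by
  constructor
  · rw [ContCaputoDiff, if_neg hα.ne']
    exact ⟨hf, (contDiffOn_rlIntegral hab hφ _).congr h⟩
  · intro x hx
    rw [caputoDeriv, if_neg hα.ne', rlDeriv, iteratedDerivWithin_congr h hx]
    exact iteratedDerivWithin_rlIntegral hab hφ _ hx

/-- The top derivative of a continuously Caputo differentiable function is, up to its initial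
value, a fractional integral of the Caputo derivative. -/
theorem iteratedDerivWithin_sub_eqOn_rlIntegral {a b α : ℝ} (hab : a < b) {k : ℕ}
    (hk : ⌈α⌉₊ = k + 1) {f : ℝ → ℝ} (hf : ContCaputoDiff a b α f) :
    EqOn (fun x => iteratedDerivWithin k f (Icc a b) x - iteratedDerivWithin k f (Icc a b) a)
      (rlIntegral a (α - k) (caputoDeriv a b α f)) (Icc a b) := by
  have hφ := continuousOn_caputoDeriv hab hf
  have hu := uniqueDiffOn_Icc hab
  obtain ⟨hkα, hαk⟩ := (Nat.ceil_eq_iff k.succ_ne_zero).1 hk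
  simp only [Nat.succ_eq_add_one, Nat.add_sub_cancel, Nat.cast_add, Nat.cast_one] at hkα hαk
  have hα : α ≠ 0 := (k.cast_nonneg.trans_lt hkα).ne'
  have hDα : ∀ x, caputoDeriv a b α f x = iteratedDerivWithin (k + 1)
      (rlIntegral a (k + 1 - α) (taylorRemainder a b α f)) (Icc a b) x := fun x => by
    simp [caputoDeriv, hα, rlDeriv, hk]
  rw [ContCaputoDiff, if_neg hα, hk, Nat.add_sub_cancel] at hf
  obtain ⟨hfk, hh⟩ := hf
  push_cast at hh
  have hψ : ContinuousOn (fun x => iteratedDerivWithin k f (Icc a b) x -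
      iteratedDerivWithin k f (Icc a b) a) (Icc a b) :=
    (hfk.continuousOn_iteratedDerivWithin le_rfl hu).sub continuousOn_const
  have hrem := taylorRemainder_eqOn hab hk hfk
  set ψ := fun x => iteratedDerivWithin k f (Icc a b) x - iteratedDerivWithin k f (Icc a b) a
    with hψdef
  have hγ : 0 ≤ (k : ℝ) + 1 - α := by linarith
  have hJψ := continuousOn_rlIntegral hγ hψ
  have hh1 : EqOn (rlIntegral a (k + 1 - α) (taylorRemainder a b α f))
      (rlIntegral a k (rlIntegral a (k + 1 - α) ψ)) (Icc a b) := by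
    have h1 := rlIntegral_rlIntegral hγ k.cast_nonneg hψ
    have h2 := rlIntegral_rlIntegral k.cast_nonneg hγ hψ
    rw [add_comm (k : ℝ) (k + 1 - α)] at h2
    exact (rlIntegral_congr _ hrem).trans (h1.trans h2.symm)
  have hDk : EqOn (iteratedDerivWithin k (rlIntegral a (k + 1 - α) (taylorRemainder a b α f))
      (Icc a b)) (rlIntegral a (k + 1 - α) ψ) (Icc a b) := fun x hx =>
    (iteratedDerivWithin_congr hh1 hx).trans (iteratedDerivWithin_rlIntegral hab hJψ k hx)
  have hderiv : ∀ x ∈ Icc a b, HasDerivWithinAt (rlIntegral a (k + 1 - α) ψ)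
      (caputoDeriv a b α f x) (Icc a b) x := fun x hx => by
    have h := (hh.differentiableOn_iteratedDerivWithin (m := k) (by norm_cast; simp) hu x
      hx).hasDerivWithinAt
    rw [← iteratedDerivWithin_succ, ← hDα] at h
    exact h.congr hDk.symm (hDk hx).symm
  have hzero : rlIntegral a (k + 1 - α) ψ a = 0 := by
    rcases hγ.eq_or_lt with h | h
    · rw [← h, rlIntegral_zero, hψdef]; simp
    · exact rlIntegral_left h _ _
  have hone := eqOn_rlIntegral_one hφ hderiv hzero
  have hδ : 0 ≤ α - k := by linarith
  have hsemi := rlIntegral_rlIntegral hγ hδ hφ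
  rw [show (k : ℝ) + 1 - α + (α - k) = 1 by ring] at hsemi
  exact eqOn_of_rlIntegral_eqOn hab hγ (by linarith) hψ (continuousOn_rlIntegral hδ hφ)
    (hone.trans hsemi.symm)

/-- The Caputo derivative of order in `(0, 1]` inverts the fractional integral. -/
theorem contCaputoDiff_of_sub_eqOn {a b γ : ℝ} (hab : a < b) (hγ : 0 < γ) (hγ1 : γ ≤ 1)
    {u φ : ℝ → ℝ} (hu : ContinuousOn u (Icc a b)) (hφ : ContinuousOn φ (Icc a b))
    (h : EqOn (fun x => u x - u a) (rlIntegral a γ φ) (Icc a b)) :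
    ContCaputoDiff a b γ u ∧ EqOn (caputoDeriv a b γ u) φ (Icc a b) := by
  have hceil : ⌈γ⌉₊ = 1 := by
    rw [Nat.ceil_eq_iff one_ne_zero]; simpa using ⟨hγ, hγ1⟩
  refine contCaputoDiff_of_rlIntegral_eqOn hab hγ (by simpa [hceil] using hu) hφ ?_
  have hrem : taylorRemainder a b γ u = fun x => u x - u a := by
    ext x; simp [taylorRemainder, hceil]
  have hsemi := rlIntegral_rlIntegral (sub_nonneg.2 hγ1) hγ.le hφ
  rw [sub_add_cancel] at hsemi
  rw [hrem, hceil, Nat.cast_one]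
  exact (rlIntegral_congr _ h).trans hsemi

/-- The Caputo derivative of natural order is the classical derivative. -/
theorem contCaputoDiff_natCast {a b : ℝ} (hab : a < b) (k : ℕ) {f : ℝ → ℝ}
    (hf : ContDiffOn ℝ k f (Icc a b)) :
    ContCaputoDiff a b k f ∧
      EqOn (caputoDeriv a b k f) (iteratedDerivWithin k f (Icc a b)) (Icc a b) := by
  have hu := uniqueDiffOn_Icc hab
  cases k with
  | zero =>
    refine ⟨by simpa [ContCaputoDiff] using hf, fun x _ => by simp [caputoDeriv]⟩
  | succ n =>
    have hpos : (0 : ℝ) < ((n + 1 : ℕ) : ℝ) := by positivity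
    have hfn : ContDiffOn ℝ n f (Icc a b) := hf.of_le (by norm_cast; simp)
    have hg : ContinuousOn (iteratedDerivWithin (n + 1) f (Icc a b)) (Icc a b) :=
      hf.continuousOn_iteratedDerivWithin le_rfl hu
    refine contCaputoDiff_of_rlIntegral_eqOn hab hpos (by rwa [Nat.ceil_natCast]) hg ?_
    rw [Nat.ceil_natCast, sub_self, rlIntegral_zero]
    have h1 : EqOn (fun x => iteratedDerivWithin n f (Icc a b) x -
        iteratedDerivWithin n f (Icc a b) a)
        (rlIntegral a 1 (iteratedDerivWithin (n + 1) f (Icc a b))) (Icc a b) := by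
      refine eqOn_rlIntegral_one hg (fun x hx => ?_) (sub_self _)
      rw [iteratedDerivWithin_succ]
      exact (hf.differentiableOn_iteratedDerivWithin (by norm_cast; simp) hu x
        hx).hasDerivWithinAt.sub_const _
    have h2 := rlIntegral_rlIntegral (γ := n) n.cast_nonneg zero_le_one hg
    rw [← Nat.cast_succ] at h2
    exact (taylorRemainder_eqOn hab (Nat.ceil_natCast _) hfn).trans
      ((rlIntegral_congr _ h1).trans h2)

end FracCalc

theorem theorem3p4 (a b : ℝ) (hab : a < b) (α β : ℝ) (hα : 0 < α)
    (hβ : (⌈α⌉₊ : ℝ) - 1 ≤ β) (hβα : β < α) (f : ℝ → ℝ)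
    (hf : ContDiffOn ℝ ((⌈α⌉₊ - 1 : ℕ) : WithTop ℕ∞) f (Set.Icc a b))
    (hfα : FracCalc.ContCaputoDiff a b α f) :
    (FracCalc.ContCaputoDiff a b β f ∧
      ContinuousOn (FracCalc.caputoDeriv a b β f) (Set.Icc a b) ∧
      ((¬ ∃ n : ℕ, β = n) → FracCalc.caputoDeriv a b β f a = 0)) ∧
    (FracCalc.ContCaputoDiff a b (α - β) (FracCalc.caputoDeriv a b β f) ∧
      ContinuousOn (FracCalc.caputoDeriv a b (α - β) (FracCalc.caputoDeriv a b β f))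
        (Set.Icc a b) ∧
      Set.EqOn (FracCalc.caputoDeriv a b (α - β) (FracCalc.caputoDeriv a b β f))
        (FracCalc.caputoDeriv a b α f) (Set.Icc a b)) := by
  open FracCalc in
  obtain ⟨k, hk⟩ : ∃ k, ⌈α⌉₊ = k + 1 :=
    Nat.exists_eq_succ_of_ne_zero (Nat.ceil_pos.2 hα).ne'
  have hαk : α ≤ k + 1 := by simpa [hk] using Nat.le_ceil α
  rw [hk, Nat.add_sub_cancel] at hf
  have hkβ : (k : ℝ) ≤ β := by rw [hk] at hβ; push_cast at hβ; linarith
  have hφ := continuousOn_caputoDeriv hab hfα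
  have hψ := iteratedDerivWithin_sub_eqOn_rlIntegral hab hk hfα
  have ha : a ∈ Icc a b := left_mem_Icc.2 hab.le
  have hδ : 0 < α - β := sub_pos.2 hβα
  suffices h : ContCaputoDiff a b β f ∧
      ((¬ ∃ n : ℕ, β = n) → caputoDeriv a b β f a = 0) ∧
      EqOn (fun x => caputoDeriv a b β f x - caputoDeriv a b β f a)
        (rlIntegral a (α - β) (caputoDeriv a b α f)) (Icc a b) by
    obtain ⟨h1, h2, h3⟩ := h
    have hc := continuousOn_caputoDeriv hab h1
    obtain ⟨h4, h5⟩ := contCaputoDiff_of_sub_eqOn hab hδ (by linarith) hc hφ h3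
    exact ⟨⟨h1, hc, h2⟩, h4, continuousOn_caputoDeriv hab h4, h5⟩
  rcases hkβ.eq_or_lt with rfl | hkβ
  · obtain ⟨h1, h2⟩ := contCaputoDiff_natCast hab k hf
    refine ⟨h1, fun h => (h ⟨k, rfl⟩).elim, fun x hx => ?_⟩
    simp only [h2 hx, h2 ha]
    exact hψ hx
  · have hceil : ⌈β⌉₊ = k + 1 := by
      rw [Nat.ceil_eq_iff k.succ_ne_zero]
      refine ⟨by simpa using hkβ, ?_⟩
      push_cast; linarith
    have hβ0 : 0 < β := k.cast_nonneg.trans_lt hkβ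
    have hrem : EqOn (taylorRemainder a b β f) (rlIntegral a α (caputoDeriv a b α f))
        (Icc a b) := by
      have h := rlIntegral_rlIntegral (γ := k) (δ := α - k) k.cast_nonneg (by linarith) hφ
      rw [add_sub_cancel] at h
      exact (taylorRemainder_eqOn hab hceil hf).trans ((rlIntegral_congr _ hψ).trans h)
    have hint : EqOn (rlIntegral a (⌈β⌉₊ - β) (taylorRemainder a b β f))
        (rlIntegral a ⌈β⌉₊ (rlIntegral a (α - β) (caputoDeriv a b α f))) (Icc a b) := by
      have h1 := rlIntegral_rlIntegral (sub_nonneg.2 (Nat.le_ceil β)) hα.le hφ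
      have h2 := rlIntegral_rlIntegral (Nat.cast_nonneg ⌈β⌉₊) hδ.le hφ
      rw [show (⌈β⌉₊ : ℝ) + (α - β) = ⌈β⌉₊ - β + α by ring] at h2
      exact (rlIntegral_congr _ hrem).trans (h1.trans h2.symm)
    obtain ⟨h1, h2⟩ := contCaputoDiff_of_rlIntegral_eqOn hab hβ0
      (by rwa [hceil, Nat.add_sub_cancel]) (continuousOn_rlIntegral hδ.le hφ) hint
    have h3 : caputoDeriv a b β f a = 0 := (h2 ha).trans (rlIntegral_left hδ _ _)
    refine ⟨h1, fun _ => h3, fun x hx => ?_⟩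
    simp only [h3, sub_zero]
    exact h2 hx
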